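/- Let $G$ be a connected real Lie group with identity $e$. For $X\in\mathfrak g=T_eG$ let $X(g)=d(R_g)_eX$ also denote the right-invariant vector field on $G$ with value $X$ at $e$, where $R_g(h)=hg$ and $L_g(h)=gh$. Let $\iota(g)=g^{-1}$, and let $d\iota X$ denote the (left-invariant) image of the right-invariant field $X$ under $\iota$, that is, $(d\iota X)(g)=d\iota_{g^{-1}}(X(g^{-1}))$. A smooth vector field $\mathcal X$ on $G$ is called linear if $\mathcal X(gh)=d(R_h)_g\mathcal X(g)+d(L_g)_h\mathcal X(h)$ for all $g,h\in G$; its derivation is $\mathcal D(Z)=-[\mathcal X,Z]$, where $Z$ runs over the right-invariant vector fields and $[\cdot,\cdot]$ is the Lie bracket of vector fields. Let $\mathcal X_0,\mathcal X_1,\dots,\mathcal X_m$ be linear vector fields and let $Y_0,Y_1,\dots,Y_m\in\mathfrak g$. Assume that the derivation $\mathcal D_i$ of each $\mathcal X_i$ is inner: there is $X_i\in\mathfrak g$ with $\mathcal D_i=\operatorname{ad}(X_i)$, $i=0,\dots,m$. Here $\operatorname{ad}(X_i)Z=[X_i,Z]$ is the usual bracket of the Lie algebra $T_eG$ of $G$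 (induced by left-invariant vector fields), and right-invariant fields are identified with their values at $e$. Let $u=(u_1,\dots,u_m)\in\mathbb R^m$ be the value of a constant control on $[0,T]$, $T\ge 0$, put $u_0=1$, and let $g\in G$. Consider the affine system $$\Sigma_A:\quad \frac{dg}{dt}=(\mathcal X_0+Y_0)(g)+\sum_{j=1}^m u_j(\mathcal X_j+Y_j)(g)$$ and the right-invariant system $$\Sigma_I:\quad \frac{dg}{dt}=(X_0+Y_0)(g)+\sum_{j=1}^m u_j(X_j+Y_j)(g).$$ Then $\mathcal X_i=X_i+d\iota X_i$ for $i=0,\dots,m$. Both systems have solutions on $[0,T]$ starting at $g$, and for all such solutions $\phi^A_t(g,u)$ of $\Sigma_A$ and $\phi^I_t(g,u)$ of $\Sigma_I$, $$\phi^A_t(g,u)=\phi^I_t(g,u)\,\exp\Bigl(-t\sum_{i=0}^m u_iX_i\Bigr)\qquad\text{for all } t\in[0,T].$$ -/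

import Mathlib

open scoped Manifold ContDiff

noncomputable section

namespace LieControl

section

variable {E : Type*} [NormedAddCommGroup E] [NormedSpace ℝ E]
  {H : Type*} [TopologicalSpace H] (I : ModelWithCorners ℝ E H)
  {G : Type*} [TopologicalSpace G] [ChartedSpace H G] [Group G]

/-- The right-invariant vector field `g ↦ d(R_g)_e X` with value `X` at the identity, where
`R_g h = h * g`. Right-invariant vector fields are identified with their values at the
identity in this way. -/
def rightField (X : GroupLieAlgebra I G) (g : G) : TangentSpace I g :=
  mfderiv I I (fun h : G => h * g) 1 X

/-- The image `dι V` of a vector field `V` under the inversion `ι g = g⁻¹`: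
`(dι V) g = d(ι)_{g⁻¹} (V g⁻¹)`. If `V` is right-invariant, then `dι V` is left-invariant. -/
def invField (V : (g : G) → TangentSpace I g) (g : G) : TangentSpace I g :=
  mfderiv I I (fun h : G => h⁻¹) g⁻¹ (V g⁻¹)

/-- A linear vector field on a Lie group: a smooth vector field `𝒳` such that
`𝒳 (g h) = d(R_h)_g (𝒳 g) + d(L_g)_h (𝒳 h)` for all `g`, `h`. -/
structure IsLinearField [IsManifold I 1 G] (𝒳 : (g : G) → TangentSpace I g) : Prop where
  smooth : ContMDiff I I.tangent ∞ (fun g : G => (⟨g, 𝒳 g⟩ : TangentBundle I G))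
  map_mul : ∀ g h : G, 𝒳 (g * h) =
    mfderiv I I (fun k : G => k * h) g (𝒳 g) + mfderiv I I (fun k : G => g * k) h (𝒳 h)

/-- The derivation `Y ↦ -[𝒳, Y]` associated to a linear vector field `𝒳`, where `Y` runs over
the right-invariant vector fields, and `[𝒳, Y]`, which is again right-invariant, is represented
by its value at the identity. -/
def derivationOf (𝒳 : (g : G) → TangentSpace I g) (Y : GroupLieAlgebra I G) :
    GroupLieAlgebra I G :=
  -VectorField.mlieBracket I 𝒳 (rightField I Y) (1 : G)

/-- `γ` is the one-parameter subgroup of `G` with velocity `X` at time `0`. -/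
structure IsOneParameterSubgroup (X : GroupLieAlgebra I G) (γ : ℝ → G) : Prop where
  map_zero : γ 0 = 1
  map_add : ∀ s t : ℝ, γ (s + t) = γ s * γ t
  hasDeriv : HasMFDerivAt 𝓘(ℝ, ℝ) I γ 0 ((1 : ℝ →L[ℝ] ℝ).smulRight (X : E))

/-- The exponential map of a Lie group: `lieExp I X = γ 1`, where `γ` is the one-parameter
subgroup with velocity `X` at time `0`. -/
def lieExp (X : GroupLieAlgebra I G) : G :=
  Classical.epsilon (IsOneParameterSubgroup I X) 1

variable {I}

/-- The vector field `V 0 + ∑ j, u j • V j` (with `j` from `1` to `m`) of a control system,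
for the control value `u`. -/
def controlField {m : ℕ} (V : Fin (m + 1) → (g : G) → TangentSpace I g) (u : Fin m → ℝ)
    (g : G) : TangentSpace I g :=
  V 0 g + ∑ j : Fin m, u j • V j.succ g

variable (I)

/-- The affine system `dg/dt = (𝒳 0 + Y 0) g + ∑ j, u j • (𝒳 j + Y j) g`. -/
def affineField {m : ℕ} (𝒳 : Fin (m + 1) → (g : G) → TangentSpace I g)
    (Y : Fin (m + 1) → GroupLieAlgebra I G) (u : Fin m → ℝ) : (g : G) → TangentSpace I g :=
  controlField (fun i g => 𝒳 i g + rightField I (Y i) g) u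

/-- The right-invariant system `dg/dt = (X 0 + Y 0) g + ∑ j, u j • (X j + Y j) g`. -/
def invariantField {m : ℕ} (X Y : Fin (m + 1) → GroupLieAlgebra I G) (u : Fin m → ℝ) :
    (g : G) → TangentSpace I g :=
  controlField (fun i g => rightField I (X i) g + rightField I (Y i) g) u

variable {I}

/-- `φ` is a solution on `[0, T]`, starting at `g`, of `dg/dt = V g`. -/
def IsSolutionOn (V : (g : G) → TangentSpace I g) (T : ℝ) (g : G) (φ : ℝ → G) : Prop :=
  φ 0 = g ∧ IsMIntegralCurveOn φ V (Set.Icc 0 T)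

end

end LieControl

end

/-! Write `R_X`, `L_X` for the right- and left-invariant fields with value `X` at the identity. The
core is `IsLinearField.eq_right_sub_left`: a linear field with derivation `ad X` equals `R_X - L_X`.
The difference `W` of the two fields obeys the same translation rule, so `F g = d(R_{g⁻¹}) (W g)` is
a cocycle, `F (g h) = F g + Ad g (F h)`. Both fields vanish at the identity, so brackets with
right-invariant fields there see only their first derivatives, which agree. Hence `dF = 0` at the
identity, by the cocycle rule everywhere, and connectedness gives `F = 0`
(`IsTranslationLinear.eq_zero`). As `dι R_X = -L_X` (`invField_rightField`), this is the first
claim.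

With `A = ∑ uᵢ Xᵢ` and `B = ∑ uᵢ Yᵢ`, the affine system is then `R_{A+B} - L_A` and the invariant
one is `R_{A+B}`. A field `R_C - L_A` has the explicit solution `exp(tC) g exp(-tA)`, unique by
`IsSolutionOn.eq_of_right_sub_left`; comparing the two solutions leaves the factor `exp(-tA)`. -/

namespace LieControl

open Set Filter Topology

/-! ### Differentials of translations and their composition rules. -/

section Translations

variable {E : Type*} [NormedAddCommGroup E] [NormedSpace ℝ E]
  {H : Type*} [TopologicalSpace H] (I : ModelWithCorners ℝ E H)
  {G : Type*} [TopologicalSpace G] [ChartedSpace H G] [Group G]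

/-- The differential at `g` of the right translation `k ↦ k * h`, read in the model space. -/
noncomputable def dRight (h g : G) : E →L[ℝ] E := mfderiv I I (fun k : G => k * h) g

/-- The differential at `g` of the left translation `k ↦ h * k`, read in the model space. -/
noncomputable def dLeft (h g : G) : E →L[ℝ] E := mfderiv I I (fun k : G => h * k) g

variable [LieGroup I ∞ G]

theorem hasMFDerivAt_mul_right (h g : G) :
    HasMFDerivAt I I (fun k : G => k * h) g (dRight I h g :) :=
  ((contMDiff_mul_right (I := I) (n := ∞) (a := h)).mdifferentiableAt (by simp)).hasMFDerivAt

theorem hasMFDerivAt_mul_left (h g : G) :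
    HasMFDerivAt I I (fun k : G => h * k) g (dLeft I h g :) :=
  ((contMDiff_mul_left (I := I) (n := ∞) (a := h)).mdifferentiableAt (by simp)).hasMFDerivAt

theorem dRight_comp (h k g : G) (v : E) :
    dRight I k (g * h) (dRight I h g v) = dRight I (h * k) g v := by
  have := (hasMFDerivAt_mul_right I k (g * h)).comp g (hasMFDerivAt_mul_right I h g)
  have h2 : HasMFDerivAt I I (fun x : G => x * (h * k)) g
      ((dRight I k (g * h)).comp (dRight I h g) :) := by
    exact this.congr_of_eventuallyEq (.of_forall fun x => by simp [mul_assoc])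
  exact (congrArg (fun L : E →L[ℝ] E => L v)
    (hasMFDerivAt_unique h2 (hasMFDerivAt_mul_right I (h * k) g)) :)

theorem dLeft_comp (h k g : G) (v : E) :
    dLeft I k (h * g) (dLeft I h g v) = dLeft I (k * h) g v := by
  have := (hasMFDerivAt_mul_left I k (h * g)).comp g (hasMFDerivAt_mul_left I h g)
  have h2 : HasMFDerivAt I I (fun x : G => (k * h) * x) g
      ((dLeft I k (h * g)).comp (dLeft I h g) :) := by
    exact this.congr_of_eventuallyEq (.of_forall fun x => by simp [mul_assoc])
  exact (congrArg (fun L : E →L[ℝ] E => L v)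
    (hasMFDerivAt_unique h2 (hasMFDerivAt_mul_left I (k * h) g)) :)

theorem dRight_dLeft (h k g : G) (v : E) :
    dRight I h (k * g) (dLeft I k g v) = dLeft I k (g * h) (dRight I h g v) := by
  have h1 := (hasMFDerivAt_mul_right I h (k * g)).comp g (hasMFDerivAt_mul_left I k g)
  have h2 := (hasMFDerivAt_mul_left I k (g * h)).comp g (hasMFDerivAt_mul_right I h g)
  have h3 : HasMFDerivAt I I ((fun x : G => x * h) ∘ fun x => k * x) g
      ((dLeft I k (g * h)).comp (dRight I h g) :) := by
    exact h2.congr_of_eventuallyEq (.of_forall fun x => by simp [mul_assoc])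
  exact (congrArg (fun L : E →L[ℝ] E => L v) (hasMFDerivAt_unique h1 h3) :)

theorem dRight_one (g : G) (v : E) : dRight I 1 g v = v := by
  have h1 : HasMFDerivAt I I (fun x : G => x * 1) g (ContinuousLinearMap.id ℝ E) := by
    rw [show (fun x : G => x * 1) = id by ext x; simp]
    exact hasMFDerivAt_id g
  exact (congrArg (fun L : E →L[ℝ] E => L v)
    (hasMFDerivAt_unique (hasMFDerivAt_mul_right I 1 g) h1) :)

theorem dLeft_one (g : G) (v : E) : dLeft I 1 g v = v := by
  have h1 : HasMFDerivAt I I (fun x : G => 1 * x) g (ContinuousLinearMap.id ℝ E) := by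
    rw [show (fun x : G => 1 * x) = id by ext x; simp]
    exact hasMFDerivAt_id g
  exact (congrArg (fun L : E →L[ℝ] E => L v)
    (hasMFDerivAt_unique (hasMFDerivAt_mul_left I 1 g) h1) :)

theorem dRight_dLeft_one (h k : G) (v : E) :
    dRight I h k (dLeft I k 1 v) = dLeft I k h (dRight I h 1 v) := by
  simpa using dRight_dLeft I h k 1 v

end Translations

/-! ### Velocities of curves: chain rule and product rule. -/

section Velocity

variable {E : Type*} [NormedAddCommGroup E] [NormedSpace ℝ E]
  {H : Type*} [TopologicalSpace H] (I : ModelWithCorners ℝ E H)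
  {G : Type*} [TopologicalSpace G] [ChartedSpace H G]

/-- The curve `γ` has velocity `v` at time `t`, within the set `s` of times. The velocity is read
in the model space. -/
def HasVelocityWithinAt (γ : ℝ → G) (v : E) (s : Set ℝ) (t : ℝ) : Prop :=
  HasMFDerivWithinAt 𝓘(ℝ, ℝ) I γ s t ((1 : ℝ →L[ℝ] ℝ).smulRight v : ℝ →L[ℝ] E)

variable {I} {γ : ℝ → G} {v : E} {s : Set ℝ} {t : ℝ}

theorem HasVelocityWithinAt.unique {w : E} (h : HasVelocityWithinAt I γ v univ t)
    (h' : HasVelocityWithinAt I γ w univ t) : v = w := by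
  have := hasMFDerivAt_unique (hasMFDerivWithinAt_univ.1 h) (hasMFDerivWithinAt_univ.1 h')
  simpa using (congrArg (fun L : ℝ →L[ℝ] E => L 1) this :)

theorem HasVelocityWithinAt.map {f : G → G} {p : G} {f' : E →L[ℝ] E}
    (h : HasVelocityWithinAt I γ v s t) (hp : γ t = p) (hf : HasMFDerivAt I I f p f') :
    HasVelocityWithinAt I (fun t => f (γ t)) (f' v) s t := by
  subst hp
  have := hf.comp_hasMFDerivWithinAt t h
  have e : ((1 : ℝ →L[ℝ] ℝ).smulRight (f' v) : ℝ →L[ℝ] E) =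
    f'.comp ((1 : ℝ →L[ℝ] ℝ).smulRight v) := by ext; simp
  unfold HasVelocityWithinAt
  rw [e]
  exact this

theorem HasVelocityWithinAt.reparam {σ : ℝ → ℝ} {c t' : ℝ}
    (h : HasVelocityWithinAt I γ v univ t') (ht : σ t = t') (hσ : HasDerivAt σ c t) :
    HasVelocityWithinAt I (fun t => γ (σ t)) (c • v) s t := by
  subst ht
  have := ((hasMFDerivWithinAt_univ.1 h).comp t hσ.hasFDerivAt.hasMFDerivAt).hasMFDerivWithinAt
    (s := s)
  have e : ((1 : ℝ →L[ℝ] ℝ).smulRight (c • v) : ℝ →L[ℝ] E) =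
    ((1 : ℝ →L[ℝ] ℝ).smulRight v).comp
      ((ContinuousLinearMap.toSpanSingleton ℝ c : ℝ →L[ℝ] ℝ)) := by ext; simp
  unfold HasVelocityWithinAt
  rw [e]
  exact this

theorem HasVelocityWithinAt.mul [Group G] [LieGroup I ∞ G] {δ : ℝ → G} {w : E}
    (h : HasVelocityWithinAt I γ v s t) (h' : HasVelocityWithinAt I δ w s t) :
    HasVelocityWithinAt I (fun t => γ t * δ t)
      (dRight I (δ t) (γ t) v + dLeft I (γ t) (δ t) w) s t := by
  have hm : MDifferentiableAt (I.prod I) I (fun p : G × G => p.1 * p.2) (γ t, δ t) :=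
    (contMDiff_mul I ∞).mdifferentiableAt (by simp)
  obtain ⟨M, hM, hMv⟩ : ∃ M : E × E →L[ℝ] E,
      HasMFDerivAt (I.prod I) I (fun p : G × G => p.1 * p.2) (γ t, δ t) M ∧
        M (v, w) = dRight I (δ t) (γ t) v + dLeft I (γ t) (δ t) w :=
    ⟨_, hm.hasMFDerivAt, mfderiv_prod_eq_add_apply hm (v := ((v, w) : E × E))⟩
  have := hM.comp_hasMFDerivWithinAt t (HasMFDerivWithinAt.prodMk h h')
  have e : ((1 : ℝ →L[ℝ] ℝ).smulRight (dRight I (δ t) (γ t) v + dLeft I (γ t) (δ t) w) :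
      ℝ →L[ℝ] E) =
    M.comp (((1 : ℝ →L[ℝ] ℝ).smulRight v : ℝ →L[ℝ] E).prod ((1 : ℝ →L[ℝ] ℝ).smulRight w)) := by
    refine ContinuousLinearMap.ext_ring ?_
    simp [hMv]
  unfold HasVelocityWithinAt
  rw [e]
  exact this

end Velocity

/-! ### One-parameter subgroups and the exponential map. -/

section OneParameterSubgroup

variable {E : Type*} [NormedAddCommGroup E] [NormedSpace ℝ E]
  {H : Type*} [TopologicalSpace H] {I : ModelWithCorners ℝ E H}
  {G : Type*} [TopologicalSpace G] [ChartedSpace H G]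

theorem isMIntegralCurve_iff_velocity {γ : ℝ → G} {V : (g : G) → TangentSpace I g} :
    IsMIntegralCurve γ V ↔ ∀ t, HasVelocityWithinAt I γ (V (γ t)) univ t :=
  forall_congr' fun _ => hasMFDerivWithinAt_univ.symm

theorem hasVelocityWithinAt_const {p : G} {s : Set ℝ} {t : ℝ} :
    HasVelocityWithinAt I (fun _ => p) 0 s t := by
  unfold HasVelocityWithinAt
  rw [show ((1 : ℝ →L[ℝ] ℝ).smulRight (0 : E) : ℝ →L[ℝ] E) = 0 by ext; simp]
  exact (hasMFDerivAt_const p t).hasMFDerivWithinAt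

variable [Group G]

theorem IsOneParameterSubgroup.velocity_zero {X : E} {γ : ℝ → G}
    (h : IsOneParameterSubgroup I X γ) : HasVelocityWithinAt I γ X univ 0 :=
  hasMFDerivWithinAt_univ.2 h.hasDeriv

theorem isOneParameterSubgroup_zero :
    IsOneParameterSubgroup (G := G) I (0 : E) (fun _ => 1) where
  map_zero := rfl
  map_add := by simp
  hasDeriv := hasMFDerivWithinAt_univ.1 hasVelocityWithinAt_const

theorem IsOneParameterSubgroup.smul {X : E} {γ : ℝ → G}
    (h : IsOneParameterSubgroup I X γ) (c : ℝ) :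
    IsOneParameterSubgroup (G := G) I (c • X : E) (fun t => γ (c * t)) where
  map_zero := by simp [h.map_zero]
  map_add s t := by rw [mul_add, h.map_add]
  hasDeriv := hasMFDerivWithinAt_univ.1
    (h.velocity_zero.reparam (σ := fun t => c * t) (c := c) (by simp)
      (by simpa using (hasDerivAt_id (0 : ℝ)).const_mul c))

theorem IsOneParameterSubgroup.mul_neg_eq_one {X : E} {γ : ℝ → G}
    (h : IsOneParameterSubgroup I X γ) (t : ℝ) : γ t * γ (-t) = 1 := by
  rw [← h.map_add]; simp [h.map_zero]

variable [LieGroup I ∞ G]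

/-- Near `t`, `γ s = γ t * γ (s - t)`. The factors commute, so `velocity_right` describes the same
velocity through right translation. -/
theorem IsOneParameterSubgroup.velocity_left {X : E} {γ : ℝ → G}
    (h : IsOneParameterSubgroup I X γ) (t : ℝ) :
    HasVelocityWithinAt I γ (dLeft I (γ t) 1 X) univ t := by
  have h1 := (h.velocity_zero.reparam (s := univ) (t := t) (σ := fun s => s - t) (c := 1) (by simp)
    (by simpa using (hasDerivAt_id t).sub_const t)).map (p := 1) (by simp [h.map_zero])
      (hasMFDerivAt_mul_left I (γ t) 1)
  simpa [← h.map_add] using h1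

theorem IsOneParameterSubgroup.velocity_right {X : E} {γ : ℝ → G}
    (h : IsOneParameterSubgroup I X γ) (t : ℝ) :
    HasVelocityWithinAt I γ (dRight I (γ t) 1 X) univ t := by
  have h1 := (h.velocity_zero.reparam (s := univ) (t := t) (σ := fun s => s - t) (c := 1) (by simp)
    (by simpa using (hasDerivAt_id t).sub_const t)).map (p := 1) (by simp [h.map_zero])
      (hasMFDerivAt_mul_right I (γ t) 1)
  simpa [← h.map_add] using h1

theorem IsOneParameterSubgroup.velocity_left_neg {X : E} {γ : ℝ → G}
    (h : IsOneParameterSubgroup I X γ) (t : ℝ) :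
    HasVelocityWithinAt I (fun t => γ (-t)) (-dLeft I (γ (-t)) 1 X) univ t := by
  simpa using (h.velocity_left (-t)).reparam (s := univ) (t := t) (σ := fun s => -s) (c := -1) rfl
    (hasDerivAt_neg t)

theorem contMDiff_mulInvariantVectorField_one (X : E) :
    ContMDiff I I.tangent 1
      (fun g : G => (⟨g, mulInvariantVectorField (I := I) (G := G) X g⟩ : TangentBundle I G)) := by
  have : LieGroup I (minSmoothness ℝ 3) G := LieGroup.of_le (n := ∞) (by
    rw [minSmoothness_of_isRCLikeNormedField]; exact ENat.LEInfty.out)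
  exact (contMDiff_mulInvariantVectorField (I := I) (G := G) X).of_le (by simp)

theorem IsOneParameterSubgroup.isMIntegralCurve {X : E} {γ : ℝ → G}
    (h : IsOneParameterSubgroup I X γ) :
    IsMIntegralCurve γ (mulInvariantVectorField (I := I) (G := G) X) :=
  isMIntegralCurve_iff_velocity.2 h.velocity_left

theorem isMIntegralCurve_const_mul {X : E} {γ : ℝ → G} {s : Set ℝ}
    (h : IsMIntegralCurveOn γ (mulInvariantVectorField (I := I) (G := G) X) s) (g : G) :
    IsMIntegralCurveOn (fun t => g * γ t) (mulInvariantVectorField (I := I) (G := G) X) s := by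
  intro t ht
  have h1 : HasVelocityWithinAt I γ (dLeft I (γ t) 1 X) s t := h t ht
  have h2 := h1.map rfl (hasMFDerivAt_mul_left I g (γ t))
  have h3 := dLeft_comp I (γ t) g 1 (X : E)
  rw [mul_one] at h3
  rw [h3] at h2
  exact h2

variable [T2Space G] [I.Boundaryless]

theorem IsOneParameterSubgroup.unique [CompleteSpace E] {X : E} {γ δ : ℝ → G}
    (h : IsOneParameterSubgroup I X γ) (h' : IsOneParameterSubgroup I X δ) : γ = δ :=
  isMIntegralCurve_Ioo_eq_of_contMDiff_boundaryless (t₀ := 0)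
    (contMDiff_mulInvariantVectorField_one X) h.isMIntegralCurve h'.isMIntegralCurve
    (h.map_zero.trans h'.map_zero.symm)

/-- Left translates of one local integral curve through the identity exist for the same time `ε` at
every point, so the left-invariant field is complete. Uniqueness of integral curves then yields the
homomorphism property. -/
theorem exists_isOneParameterSubgroup [CompleteSpace E] (X : E) :
    ∃ γ : ℝ → G, IsOneParameterSubgroup I X γ := by
  have hs := contMDiff_mulInvariantVectorField_one (I := I) (G := G) X
  obtain ⟨γ₀, h0, hγ₀⟩ := exists_isMIntegralCurveAt_of_contMDiffAt_boundaryless (t₀ := 0)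
    (hs.contMDiffAt (x := 1))
  obtain ⟨ε, hε, hγ₀⟩ := isMIntegralCurveAt_iff'.1 hγ₀
  rw [Real.ball_eq_Ioo, zero_sub, zero_add] at hγ₀
  obtain ⟨γ, h1, hγ⟩ := exists_isMIntegralCurve_of_isMIntegralCurveOn hs hε
    (fun x => ⟨fun t => x * γ₀ t, by simp [h0], isMIntegralCurve_const_mul hγ₀ x⟩) 1
  refine ⟨γ, h1, fun s t => ?_, ?_⟩
  · have hl : IsMIntegralCurve (γ ∘ (· + s)) (mulInvariantVectorField (I := I) (G := G) X) :=
      hγ.comp_add s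
    have hr : IsMIntegralCurve (fun t => γ s * γ t) (mulInvariantVectorField (I := I) (G := G) X) :=
      isMIntegralCurve_iff_isMIntegralCurveOn.2
        (isMIntegralCurve_const_mul (hγ.isMIntegralCurveOn univ) (γ s))
    have := isMIntegralCurve_Ioo_eq_of_contMDiff_boundaryless (t₀ := 0) hs hl hr (by simp [h1])
    simpa [add_comm] using congrFun this t
  · have h2 := isMIntegralCurve_iff_velocity.1 hγ 0
    have h3 : HasVelocityWithinAt I γ (dLeft I (γ 0) 1 X) univ 0 := h2
    rw [h1, dLeft_one] at h3
    exact hasMFDerivWithinAt_univ.1 h3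

/-- Existence makes the `epsilon` in `lieExp` a genuine one-parameter subgroup; uniqueness
identifies it with `s ↦ γ (t * s)`. -/
theorem lieExp_smul [CompleteSpace E] {X : E} {γ : ℝ → G}
    (h : IsOneParameterSubgroup I X γ) (t : ℝ) : lieExp I (t • X : E) = γ t := by
  have h1 : IsOneParameterSubgroup (G := G) I (t • X : E)
      (Classical.epsilon (IsOneParameterSubgroup (G := G) I (t • X : E))) :=
    Classical.epsilon_spec ⟨_, h.smul t⟩
  have h2 := congrFun (h1.unique (h.smul t)) 1
  rw [mul_one] at h2
  exact h2

end OneParameterSubgroup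

/-! ### Explicit solutions for fields of the form right-invariant minus left-invariant. -/

section Solutions

variable {E : Type*} [NormedAddCommGroup E] [NormedSpace ℝ E]
  {H : Type*} [TopologicalSpace H] {I : ModelWithCorners ℝ E H}
  {G : Type*} [TopologicalSpace G] [ChartedSpace H G] [Group G] [LieGroup I ∞ G]

/-- Both sides are the velocity at `0` of one curve, `(γ t * g⁻¹)⁻¹ = g * γ (-t)`. -/
theorem invField_rightField [T2Space G] [I.Boundaryless] [CompleteSpace E]
    (X : E) (g : G) :
    (invField (G := G) I (rightField I X) g : E) = -dLeft I g 1 X := by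
  obtain ⟨γ, h⟩ := exists_isOneParameterSubgroup (I := I) (G := G) X
  have hinv : HasMFDerivAt I I (fun k : G => k⁻¹) g⁻¹ (mfderiv I I (fun k : G => k⁻¹) g⁻¹) :=
    ((contMDiff_inv I ∞).mdifferentiableAt (by simp)).hasMFDerivAt
  have h1 := (h.velocity_zero.map h.map_zero (hasMFDerivAt_mul_right I g⁻¹ 1)).map
    (p := g⁻¹) (by simp [h.map_zero]) hinv
  have h2 := (h.velocity_left_neg 0).map (p := 1) (by simp [h.map_zero])
    (hasMFDerivAt_mul_left I g 1)
  have e : (fun t => (γ t * g⁻¹)⁻¹) = fun t => g * γ (-t) := by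
    funext t
    rw [mul_inv_rev, inv_inv, inv_eq_of_mul_eq_one_right (h.mul_neg_eq_one t)]
  rw [e] at h1
  have h3 := h1.unique h2
  simp only [neg_zero, h.map_zero, dLeft_one, map_neg] at h3
  exact h3

/-- Such a curve is an integral curve of the zero field. Uniqueness is applied on the open interval,
based at its midpoint, and continuity reaches the endpoints. -/
theorem eqOn_Icc_of_velocity_zero [T2Space G] [I.Boundaryless] [CompleteSpace E]
    {γ : ℝ → G} {T : ℝ} (h : ∀ t ∈ Icc 0 T, HasVelocityWithinAt I γ 0 (Icc 0 T) t) :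
    ∀ t ∈ Icc 0 T, γ t = γ 0 := by
  intro t ht
  rcases ht.1.eq_or_lt with rfl | ht0
  · rfl
  have hT : 0 < T := ht0.trans_le ht.2
  have hc : ContinuousOn γ (Icc 0 T) := fun t ht => (h t ht).1
  have hmid : T / 2 ∈ Ioo 0 T := ⟨by linarith, by linarith⟩
  have hz : ContMDiff I I.tangent 1 (fun g : G => (⟨g, 0⟩ : TangentBundle I G)) :=
    Bundle.contMDiff_zeroSection ℝ (TangentSpace I : G → Type _)
  have e1 : EqOn γ (fun _ => γ (T / 2)) (Ioo 0 T) :=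
    isMIntegralCurveOn_Ioo_eqOn_of_contMDiff_boundaryless hmid hz
      (fun t ht => (h t (Ioo_subset_Icc_self ht)).mono Ioo_subset_Icc_self)
      ((isMIntegralCurve_const rfl).isMIntegralCurveOn _) rfl
  have e2 : EqOn γ (fun _ => γ (T / 2)) (Icc 0 T) :=
    e1.of_subset_closure hc continuousOn_const Ioo_subset_Icc_self
      (by rw [closure_Ioo hT.ne])
  rw [e2 ht, e2 (left_mem_Icc.2 hT.le)]

theorem isSolutionOn_of_right_sub_left {V : (g : G) → TangentSpace I g}
    {A C : E} (hV : ∀ h : G, (V h : E) = dRight I h 1 C - dLeft I h 1 A)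
    {α β : ℝ → G} (hα : IsOneParameterSubgroup I A α) (hβ : IsOneParameterSubgroup I C β)
    (T : ℝ) (g : G) : IsSolutionOn V T g (fun t => β t * g * α (-t)) := by
  refine ⟨by simp [hα.map_zero, hβ.map_zero], ?_⟩
  suffices h : ∀ t, HasVelocityWithinAt I (fun t => β t * g * α (-t))
      (V (β t * g * α (-t))) univ t from
    (isMIntegralCurve_iff_velocity.2 h).isMIntegralCurveOn _
  intro t
  have h1 := ((hβ.velocity_right t).map rfl (hasMFDerivAt_mul_right I g (β t))).mul
    (hα.velocity_left_neg t)
  convert h1 using 1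
  have e1 := dRight_comp I (β t) g 1 (C : E)
  have e2 := dRight_comp I (β t * g) (α (-t)) 1 (C : E)
  have e3 := dLeft_comp I (α (-t)) (β t * g) 1 (A : E)
  rw [one_mul] at e1 e2
  rw [mul_one] at e3
  rw [hV, e1, e2, map_neg, e3, sub_eq_add_neg]

theorem IsSolutionOn.eq_of_right_sub_left [T2Space G] [I.Boundaryless] [CompleteSpace E]
    {V : (g : G) → TangentSpace I g}
    {A C : E} (hV : ∀ h : G, (V h : E) = dRight I h 1 C - dLeft I h 1 A)
    {α β : ℝ → G} (hα : IsOneParameterSubgroup I A α) (hβ : IsOneParameterSubgroup I C β)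
    {T : ℝ} {g : G} {φ : ℝ → G} (hφ : IsSolutionOn V T g φ) {t : ℝ} (ht : t ∈ Icc 0 T) :
    φ t = β t * g * α (-t) := by
  -- Undoing the expected flow on both sides: the velocities of `β (-t)` and `α t` cancel the right
  -- and left parts of `V`.
  have key : ∀ t ∈ Icc 0 T,
      HasVelocityWithinAt I (fun t => β (-t) * φ t * α t) 0 (Icc 0 T) t := by
    intro t ht
    have h0 : HasVelocityWithinAt I φ (V (φ t)) (Icc 0 T) t := hφ.2 t ht
    have h1 := (HasVelocityWithinAt.mul ((hβ.velocity_left_neg t).mono (subset_univ _)) h0).mul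
      ((hα.velocity_right t).mono (subset_univ _))
    convert h1 using 1
    have e3 := dLeft_comp I (φ t) (β (-t)) 1 (A : E)
    rw [mul_one] at e3
    rw [hV, map_neg, dRight_dLeft_one, map_sub, e3, neg_add_eq_sub, sub_sub_cancel_left, map_neg,
      dRight_dLeft_one, neg_add_cancel]
  have h2 := eqOn_Icc_of_velocity_zero key t ht
  simp only [neg_zero, hβ.map_zero, hα.map_zero, hφ.1, one_mul, mul_one] at h2
  have hb := eq_inv_of_mul_eq_one_right (hβ.mul_neg_eq_one t)
  have ha := eq_inv_of_mul_eq_one_right (hα.mul_neg_eq_one t)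
  rw [← h2, hb, ha]
  group

end Solutions

/-! ### The Lie bracket at the identity, computed in a chart. -/

section ChartAtOne

variable {E : Type*} [NormedAddCommGroup E] [NormedSpace ℝ E]
  {H : Type*} [TopologicalSpace H] (I : ModelWithCorners ℝ E H)
  {G : Type*} [TopologicalSpace G] [ChartedSpace H G]

variable {I} in
theorem hasFDerivAt_comp_extChartAt_symm [I.Boundaryless] {f : G → E} {g : G}
    {f' : E →L[ℝ] E} (h : HasMFDerivAt I 𝓘(ℝ, E) f g f') :
    HasFDerivAt (f ∘ (extChartAt I g).symm) f' (extChartAt I g g) := by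
  have : HasFDerivWithinAt (f ∘ (extChartAt I g).symm) f' (range I) (extChartAt I g g) := h.2
  rwa [I.range_eq_univ, hasFDerivWithinAt_univ] at this

variable [Group G]

/-- The expression of a vector field in the extended chart at the identity. -/
noncomputable def chartField (V : G → E) (x : E) : E :=
  ((mfderivWithin 𝓘(ℝ, E) I (extChartAt I (1 : G)).symm (range I) x).inverse : E →L[ℝ] E)
    (V ((extChartAt I (1 : G)).symm x))

variable (G) in
/-- The multiplication of the group, expressed in the extended chart at the identity. -/
noncomputable def chartMul (p : E × E) : E :=
  extChartAt I (1 : G) ((extChartAt I (1 : G)).symm p.1 * (extChartAt I (1 : G)).symm p.2)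

variable (G) in
/-- The coordinates of the identity. -/
noncomputable def chartOne : E := extChartAt I (1 : G) 1

@[simp]
theorem extChartAt_symm_chartOne : (extChartAt I (1 : G)).symm (chartOne I G) = 1 :=
  extChartAt_to_inv 1

theorem chartField_sub (V W : G → E) (x : E) :
    chartField I (V - W) x = chartField I V x - chartField I W x := map_sub _ _ _

variable [LieGroup I ∞ G]

theorem chartField_chartOne (V : G → E) : chartField I V (chartOne I G) = V 1 := by
  -- Only the argument of `V` is generalised, so that it can be replaced by `1` without touching the
  -- base point of the differential.
  have h : ∀ g : G, g = 1 → ((mfderivWithin 𝓘(ℝ, E) I (extChartAt I (1 : G)).symm (range I)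
      (chartOne I G)).inverse : E →L[ℝ] E) (V g) = V 1 := by
    rintro g rfl
    exact mfderivWithin_extChartAt_symm_inverse_apply (I := I) (x := (1 : G)) (V 1)
  exact h _ (extChartAt_symm_chartOne I)

theorem chartField_eq (V : G → E) {x : E} (hx : x ∈ (extChartAt I (1 : G)).target) :
    chartField I V x = (mfderiv I 𝓘(ℝ, E) (extChartAt I (1 : G)) ((extChartAt I (1 : G)).symm x) :
      E →L[ℝ] E) (V ((extChartAt I (1 : G)).symm x)) := by
  have h := ContinuousLinearMap.inverse_eq
    (mfderivWithin_extChartAt_symm_comp_mfderiv_extChartAt (I := I) hx)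
    (mfderiv_extChartAt_comp_mfderivWithin_extChartAt_symm (I := I) hx)
  exact (congrArg (fun L : E →L[ℝ] E => L (V ((extChartAt I (1 : G)).symm x))) h :)

variable [I.Boundaryless]

theorem contDiffAt_chartMul : ContDiffAt ℝ ∞ (chartMul I G) (chartOne I G, chartOne I G) := by
  rw [← contMDiffAt_iff_contDiffAt]
  have hs : ContMDiffAt 𝓘(ℝ, E) I ∞ (extChartAt I (1 : G)).symm (chartOne I G) :=
    (contMDiffOn_extChartAt_symm (1 : G)).contMDiffAt (extChartAt_target_mem_nhds 1)
  have h1 : ContMDiffAt 𝓘(ℝ, E × E) I ∞ (fun p : E × E => (extChartAt I (1 : G)).symm p.1)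
      (chartOne I G, chartOne I G) :=
    hs.comp (chartOne I G, chartOne I G) contDiff_fst.contMDiff.contMDiffAt
  have h2 : ContMDiffAt 𝓘(ℝ, E × E) I ∞ (fun p : E × E => (extChartAt I (1 : G)).symm p.2)
      (chartOne I G, chartOne I G) :=
    hs.comp (chartOne I G, chartOne I G) contDiff_snd.contMDiff.contMDiffAt
  refine ContMDiffAt.comp (chartOne I G, chartOne I G) ?_ (h1.mul h2)
  exact contMDiffAt_extChartAt' (by
    rw [extChartAt_symm_chartOne, mul_one]; exact mem_chart_source H 1)

/-- With `g` the point of coordinates `x`, right translation by `g` reads `y ↦ chartMul (y, x)` in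
the chart, so its differential at the identity is a partial derivative of `chartMul`. -/
theorem chartField_rightField_of_mem_target (Z : E) {x : E} (hx : x ∈ (extChartAt I (1 : G)).target)
    (hd : DifferentiableAt ℝ (chartMul I G) (chartOne I G, x)) :
    chartField I (fun g : G => dRight I g 1 Z) x
      = fderiv ℝ (chartMul I G) (chartOne I G, x) (Z, 0) := by
  set g := (extChartAt I (1 : G)).symm x with hg
  have hgs : g ∈ (chartAt H (1 : G)).source := by
    rw [← extChartAt_source I]; exact (extChartAt I (1 : G)).map_target hx
  have h1 : HasMFDerivAt I 𝓘(ℝ, E) (extChartAt I (1 : G)) (1 * g)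
      (mfderiv I 𝓘(ℝ, E) (extChartAt I (1 : G)) (1 * g)) :=
    (mdifferentiableAt_extChartAt (by rwa [one_mul])).hasMFDerivAt
  have h2 := hasFDerivAt_comp_extChartAt_symm
    (h1.comp 1 (hasMFDerivAt_mul_right I g 1))
  have h3 : HasFDerivAt (fun y : E => (y, x)) (ContinuousLinearMap.inl ℝ E E) (chartOne I G) :=
    hasFDerivAt_prodMk_left _ _
  have h4 := hd.hasFDerivAt.comp (chartOne I G) h3
  have h5 := (congrArg (fun L : E →L[ℝ] E => L Z) (h2.unique h4) :)
  rw [one_mul] at h5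
  rw [chartField_eq I _ hx]
  refine h5.trans ?_
  simp

theorem chartField_leftField_of_mem_target (Z : E) {x : E} (hx : x ∈ (extChartAt I (1 : G)).target)
    (hd : DifferentiableAt ℝ (chartMul I G) (x, chartOne I G)) :
    chartField I (fun g : G => dLeft I g 1 Z) x
      = fderiv ℝ (chartMul I G) (x, chartOne I G) (0, Z) := by
  set g := (extChartAt I (1 : G)).symm x with hg
  have hgs : g ∈ (chartAt H (1 : G)).source := by
    rw [← extChartAt_source I]; exact (extChartAt I (1 : G)).map_target hx
  have h1 : HasMFDerivAt I 𝓘(ℝ, E) (extChartAt I (1 : G)) (g * 1)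
      (mfderiv I 𝓘(ℝ, E) (extChartAt I (1 : G)) (g * 1)) :=
    (mdifferentiableAt_extChartAt (by rwa [mul_one])).hasMFDerivAt
  have h2 := hasFDerivAt_comp_extChartAt_symm
    (h1.comp 1 (hasMFDerivAt_mul_left I g 1))
  have h3 : HasFDerivAt (fun y : E => (x, y)) (ContinuousLinearMap.inr ℝ E E) (chartOne I G) :=
    hasFDerivAt_prodMk_right _ _
  have h4 := hd.hasFDerivAt.comp (chartOne I G) h3
  have h5 := (congrArg (fun L : E →L[ℝ] E => L Z) (h2.unique h4) :)
  rw [mul_one] at h5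
  rw [chartField_eq I _ hx]
  refine h5.trans ?_
  simp

theorem eventually_differentiableAt_chartMul :
    ∀ᶠ p in 𝓝 (chartOne I G, chartOne I G), DifferentiableAt ℝ (chartMul I G) p := by
  filter_upwards [((contDiffAt_chartMul I (G := G)).of_le (m := 1) (by simp)).eventually (by simp)]
    with p hp using hp.differentiableAt (by simp)

theorem eventually_chartField_rightField :
    ∀ᶠ x in 𝓝 (chartOne I G), ∀ Z : E, chartField I (fun g : G => dRight I g 1 Z) x
      = fderiv ℝ (chartMul I G) (chartOne I G, x) (Z, 0) := by
  have hc : Tendsto (fun x : E => (chartOne I G, x)) (𝓝 (chartOne I G))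
      (𝓝 (chartOne I G, chartOne I G)) := (Continuous.prodMk_right _).tendsto _
  filter_upwards [extChartAt_target_mem_nhds (I := I) (1 : G),
    hc.eventually (eventually_differentiableAt_chartMul I)] with x hx hd Z
  exact chartField_rightField_of_mem_target I Z hx hd

theorem eventually_chartField_leftField :
    ∀ᶠ x in 𝓝 (chartOne I G), ∀ Z : E, chartField I (fun g : G => dLeft I g 1 Z) x
      = fderiv ℝ (chartMul I G) (x, chartOne I G) (0, Z) := by
  have hc : Tendsto (fun x : E => (x, chartOne I G)) (𝓝 (chartOne I G))
      (𝓝 (chartOne I G, chartOne I G)) := (Continuous.prodMk_left _).tendsto _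
  filter_upwards [extChartAt_target_mem_nhds (I := I) (1 : G),
    hc.eventually (eventually_differentiableAt_chartMul I)] with x hx hd Z
  exact chartField_leftField_of_mem_target I Z hx hd

theorem hasFDerivAt_fderiv_chartMul : HasFDerivAt (fderiv ℝ (chartMul I G))
    (fderiv ℝ (fderiv ℝ (chartMul I G)) (chartOne I G, chartOne I G))
    (chartOne I G, chartOne I G) :=
  (((contDiffAt_chartMul I (G := G)).fderiv_right (m := 1) (by
    rw [one_add_one_eq_two]; exact ENat.LEInfty.out)
    ).differentiableAt (by simp)).hasFDerivAt

variable (G) in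
/-- The mixed second derivative at the identity of the multiplication in the chart. -/
noncomputable def chartMulMixed (v w : E) : E :=
  fderiv ℝ (fderiv ℝ (chartMul I G)) (chartOne I G, chartOne I G) (v, 0) (0, w)

/-- Differentiating `x ↦ D chartMul (e, x) (Z, 0)` gives the second derivative on `(0, w), (Z, 0)`;
its symmetry puts the arguments in the order of `chartMulMixed`. For left fields the order is
already right. -/
theorem exists_hasFDerivAt_chartField_rightField (Z : E) :
    ∃ L : E →L[ℝ] E, (∀ w, L w = chartMulMixed I G Z w) ∧
      HasFDerivAt (chartField I (fun g : G => dRight I g 1 Z)) L (chartOne I G) := by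
  have h3 : HasFDerivAt (fun y : E => (chartOne I G, y)) (ContinuousLinearMap.inr ℝ E E)
    (chartOne I G) := hasFDerivAt_prodMk_right _ _
  have h4 := ((hasFDerivAt_fderiv_chartMul I (G := G)).comp (chartOne I G) h3).clm_apply
    (hasFDerivAt_const ((Z, 0) : E × E) _)
  refine ⟨_, fun w => ?_, h4.congr_of_eventuallyEq
    ((eventually_chartField_rightField I (G := G)).mono fun x hx => hx Z)⟩
  have hs := ((contDiffAt_chartMul I (G := G)).isSymmSndFDerivAt
    (by rw [minSmoothness_of_isRCLikeNormedField]; exact ENat.LEInfty.out)) (Z, 0) (0, w)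
  simp [chartMulMixed, hs]

theorem exists_hasFDerivAt_chartField_leftField (Z : E) :
    ∃ L : E →L[ℝ] E, (∀ w, L w = chartMulMixed I G w Z) ∧
      HasFDerivAt (chartField I (fun g : G => dLeft I g 1 Z)) L (chartOne I G) := by
  have h3 : HasFDerivAt (fun y : E => (y, chartOne I G)) (ContinuousLinearMap.inl ℝ E E)
    (chartOne I G) := hasFDerivAt_prodMk_left _ _
  have h4 := (HasFDerivAt.comp (f := fun y : E => (y, chartOne I G)) (chartOne I G)
    (hasFDerivAt_fderiv_chartMul I (G := G)) h3).clm_apply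
    (hasFDerivAt_const ((0, Z) : E × E) _)
  refine ⟨_, fun w => ?_, h4.congr_of_eventuallyEq
    ((eventually_chartField_leftField I (G := G)).mono fun x hx => hx Z)⟩
  simp [chartMulMixed]

/-- The chart at the identity has identity differential there, so the bracket is the vector-space
bracket of the coordinate expressions. -/
theorem mlieBracket_one (V W : G → E) {V' W' : E →L[ℝ] E}
    (hV : HasFDerivAt (chartField I V) V' (chartOne I G))
    (hW : HasFDerivAt (chartField I W) W' (chartOne I G)) :
    (VectorField.mlieBracket I (V : (g : G) → TangentSpace I g) W 1 : E) = W' (V 1) - V' (W 1) := by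
  have hi : (mfderiv I 𝓘(ℝ, E) (extChartAt I (1 : G)) 1).inverse =
      ContinuousLinearMap.id ℝ (TangentSpace I (1 : G)) := by
    rw [mfderiv_extChartAt_self]
    exact ContinuousLinearMap.inverse_id
  have h := (congrArg (fun L : E →L[ℝ] E => L
    (VectorField.lieBracketWithin ℝ (chartField I V) (chartField I W)
        ((extChartAt I (1 : G)).symm ⁻¹' univ ∩ range I) (chartOne I G))) hi :)
  refine h.trans ?_
  change VectorField.lieBracketWithin ℝ (chartField I V) (chartField I W)
    ((extChartAt I (1 : G)).symm ⁻¹' univ ∩ range I) (chartOne I G) = _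
  rw [preimage_univ, univ_inter, I.range_eq_univ, ← chartField_chartOne I V,
    ← chartField_chartOne I W, ← hV.fderiv, ← hW.fderiv, VectorField.lieBracketWithin_univ]
  rfl

theorem bracket_eq_chartMulMixed (X Z : E) :
    Bracket.bracket (L := GroupLieAlgebra I G) (M := GroupLieAlgebra I G) X Z =
      (chartMulMixed I G X Z - chartMulMixed I G Z X : E) := by
  obtain ⟨LX, hLX, hX⟩ := exists_hasFDerivAt_chartField_leftField I (G := G) X
  obtain ⟨LZ, hLZ, hZ⟩ := exists_hasFDerivAt_chartField_leftField I (G := G) Z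
  have h := mlieBracket_one I _ _ hX hZ
  rw [hLX, hLZ, dLeft_one, dLeft_one] at h
  exact h

end ChartAtOne

/-! ### Functions with vanishing differential. -/

section LocallyConstant

variable {E : Type*} [NormedAddCommGroup E] [NormedSpace ℝ E]
  {H : Type*} [TopologicalSpace H] {I : ModelWithCorners ℝ E H} [I.Boundaryless]
  {G : Type*} [TopologicalSpace G] [ChartedSpace H G] [IsManifold I 1 G]

theorem isLocallyConstant_of_hasMFDerivAt_zero {F : G → E}
    (hF : ∀ g, HasMFDerivAt I 𝓘(ℝ, E) F g (0 : E →L[ℝ] E)) : IsLocallyConstant F := by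
  rw [IsLocallyConstant.iff_eventually_eq]
  intro g
  have hd : ∀ x ∈ (extChartAt I g).target,
      HasFDerivAt (F ∘ (extChartAt I g).symm) (0 : E →L[ℝ] E) x := by
    intro x hx
    have h1 := (mdifferentiableWithinAt_extChartAt_symm (I := I) hx)
    rw [I.range_eq_univ, mdifferentiableWithinAt_univ] at h1
    have h2 := ((hF _).comp x h1.hasMFDerivAt).hasFDerivAt
    have h3 : ∀ L : E →L[ℝ] E, (0 : E →L[ℝ] E).comp L = 0 := fun L => by simp
    exact h2.congr_fderiv (h3 _)
  obtain ⟨r, hr, hball⟩ := Metric.mem_nhds_iff.1 (extChartAt_target_mem_nhds (I := I) g)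
  have hc : ∀ x ∈ Metric.ball (extChartAt I g g) r,
      F ((extChartAt I g).symm x) = F ((extChartAt I g).symm (extChartAt I g g)) := fun x hx =>
    Metric.isOpen_ball.is_const_of_fderiv_eq_zero (𝕜 := ℝ) (f := F ∘ (extChartAt I g).symm)
      (convex_ball _ _).isPreconnected
      (fun y hy => (hd y (hball hy)).differentiableAt.differentiableWithinAt)
      (fun y hy => (hd y (hball hy)).fderiv) hx (Metric.mem_ball_self hr)
  filter_upwards [extChartAt_source_mem_nhds (I := I) g,
    (continuousAt_extChartAt (I := I) g).preimage_mem_nhds (Metric.ball_mem_nhds _ hr)] with y hy hyb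
  have := hc _ hyb
  rwa [(extChartAt I g).left_inv hy, extChartAt_to_inv] at this

end LocallyConstant

/-! ### Linear vector fields are determined by their first derivative at the identity. -/

section LinearFields

variable {E : Type*} [NormedAddCommGroup E] [NormedSpace ℝ E]
  {H : Type*} [TopologicalSpace H] {I : ModelWithCorners ℝ E H}
  {G : Type*} [TopologicalSpace G] [ChartedSpace H G] [Group G]

variable (I) in
/-- The translation rule of linear vector fields, for fields read in the model space. -/
def IsTranslationLinear (W : G → E) : Prop :=
  ∀ g h : G, W (g * h) = dRight I h g (W g) + dLeft I g h (W h)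

theorem IsTranslationLinear.sub {V W : G → E} (hV : IsTranslationLinear I V)
    (hW : IsTranslationLinear I W) : IsTranslationLinear I (V - W) := by
  intro g h
  simp only [Pi.sub_apply, hV g h, hW g h, map_sub]
  abel

variable [LieGroup I ∞ G]

theorem IsLinearField.isTranslationLinear {𝒳 : (g : G) → TangentSpace I g}
    (h : IsLinearField I 𝒳) : IsTranslationLinear I (𝒳 : G → E) := h.map_mul

/-- The mixed terms cancel because left and right translations commute. -/
theorem isTranslationLinear_right_sub_left (X : E) :
    IsTranslationLinear I (fun g : G => dRight I g 1 X - dLeft I g 1 X) := by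
  intro g h
  have e1 := dRight_comp I g h 1 X
  have e2 := dLeft_comp I h g 1 X
  rw [one_mul] at e1
  rw [mul_one] at e2
  simp only [map_sub, e1, e2, dRight_dLeft_one]
  abel

theorem IsTranslationLinear.map_one {W : G → E} (hW : IsTranslationLinear I W) : W 1 = 0 := by
  have h := hW 1 1
  rw [dRight_one, dLeft_one, mul_one] at h
  simpa using h

/-- The cocycle rule `F (g h) = F g + Ad g (F h)` for the right-trivialised field `F`. -/
theorem IsTranslationLinear.logDeriv_mul {W : G → E} (hW : IsTranslationLinear I W) (g h : G) :
    dRight I (g * h)⁻¹ (g * h) (W (g * h)) =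
      dRight I g⁻¹ g (W g) + dRight I g⁻¹ g (dLeft I g 1 (dRight I h⁻¹ h (W h))) := by
  have hWh : dRight I h 1 (dRight I h⁻¹ h (W h)) = W h := by
    simpa [dRight_one] using dRight_comp I h⁻¹ h h (W h)
  rw [hW g h, map_add, dRight_comp]
  nth_rewrite 1 [← hWh]
  rw [← dRight_dLeft_one, dRight_comp]
  simp

variable [I.Boundaryless]

/-- In the chart, the differential of right translation depends continuously on the point and is the
identity at the identity; within `1 / 2` of it, it shrinks norms by at most a factor of two. The
bound turns estimates on `W` into estimates on `F`. -/
theorem eventually_norm_le_two_mul_norm_chartField_rightField :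
    ∀ᶠ x in 𝓝 (chartOne I G), ∀ Z : E,
      ‖Z‖ ≤ 2 * ‖chartField I (fun g : G => dRight I g 1 Z) x‖ := by
  set N : E → E →L[ℝ] E := fun x =>
    (fderiv ℝ (chartMul I G) (chartOne I G, x)).comp (ContinuousLinearMap.inl ℝ E E) with hN
  have h1 : N (chartOne I G) = ContinuousLinearMap.id ℝ E := by
    ext Z
    have h2 := (eventually_chartField_rightField I (G := G)).self_of_nhds Z
    rw [chartField_chartOne, dRight_one] at h2
    simp [hN, ← h2]
  have hc : ContinuousAt N (chartOne I G) := by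
    have h2 : ContinuousAt (fun x => fderiv ℝ (chartMul I G) (chartOne I G, x)) (chartOne I G) :=
      ContinuousAt.comp (f := fun x => (chartOne I G, x)) (g := fderiv ℝ (chartMul I G))
        (hasFDerivAt_fderiv_chartMul I (G := G)).continuousAt
        (Continuous.prodMk_right _).continuousAt
    exact h2.clm_comp continuousAt_const
  have hn : ∀ᶠ x in 𝓝 (chartOne I G), ‖N x - ContinuousLinearMap.id ℝ E‖ < 1 / 2 := by
    have h3 := hc.sub (continuousAt_const (y := ContinuousLinearMap.id ℝ E))
    have h4 := h3.norm
    have h5 : ‖N (chartOne I G) - ContinuousLinearMap.id ℝ E‖ < 1 / 2 := by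
      rw [h1, sub_self, norm_zero]; norm_num
    exact h4.eventually_lt continuousAt_const h5
  filter_upwards [hn, eventually_chartField_rightField I (G := G)] with x hx hxr Z
  have h6 : chartField I (fun g : G => dRight I g 1 Z) x = N x Z := by simp [hxr, hN]
  rw [h6]
  have h7 := (N x - ContinuousLinearMap.id ℝ E).le_of_opNorm_le hx.le Z
  have h8 : ‖Z‖ ≤ ‖N x Z‖ + ‖(N x - ContinuousLinearMap.id ℝ E) Z‖ := by
    have := norm_sub_le (N x Z) ((N x - ContinuousLinearMap.id ℝ E) Z)
    simpa using this
  linarith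

/-- Near the identity `F` is `O(W)`, and `W` vanishes to first order there, so no derivative of `g ↦
dRight I g⁻¹ g` is needed. -/
theorem IsTranslationLinear.hasMFDerivAt_logDeriv_one {W : G → E} (hW : IsTranslationLinear I W)
    (hd : HasFDerivAt (chartField I W) (0 : E →L[ℝ] E) (chartOne I G)) :
    HasMFDerivAt I 𝓘(ℝ, E) (fun g : G => dRight I g⁻¹ g (W g)) 1 (0 : E →L[ℝ] E) := by
  set F : G → E := fun g => dRight I g⁻¹ g (W g) with hF
  have hWF : ∀ g, W g = dRight I g 1 (F g) := fun g => by
    simpa [dRight_one] using (dRight_comp I g⁻¹ g g (W g)).symm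
  have hbd : ∀ᶠ x in 𝓝 (chartOne I G),
      ‖F ((extChartAt I (1 : G)).symm x)‖ ≤ 2 * ‖chartField I W x‖ := by
    filter_upwards [eventually_norm_le_two_mul_norm_chartField_rightField (I := I) (G := G)]
      with x hx
    have h1 := hx (F ((extChartAt I (1 : G)).symm x))
    have h2 : chartField I W x =
        chartField I (fun g : G => dRight I g 1 (F ((extChartAt I (1 : G)).symm x))) x :=
      congrArg _ (hWF ((extChartAt I (1 : G)).symm x))
    rwa [← h2] at h1
  have h0 : F 1 = 0 := by simp [hF, hW.map_one]
  have hFd : HasFDerivAt (F ∘ (extChartAt I (1 : G)).symm) (0 : E →L[ℝ] E) (chartOne I G) := by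
    rw [hasFDerivAt_iff_isLittleO] at hd ⊢
    have hW0 : chartField I W (chartOne I G) = 0 := by rw [chartField_chartOne, hW.map_one]
    refine Asymptotics.IsBigO.trans_isLittleO (Asymptotics.IsBigO.of_bound 2 ?_) hd
    filter_upwards [hbd] with x hx
    simpa only [Function.comp_apply, extChartAt_symm_chartOne, h0, hW0, sub_zero,
      _root_.zero_apply] using hx
  have hφ : HasMFDerivAt I 𝓘(ℝ, E) (extChartAt I (1 : G)) 1
      (mfderiv I 𝓘(ℝ, E) (extChartAt I (1 : G)) 1) :=
    (mdifferentiableAt_extChartAt (mem_chart_source H 1)).hasMFDerivAt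
  have h1 := HasMFDerivAt.comp (1 : G) (hFd.hasMFDerivAt :) hφ
  have h3 : ∀ L : E →L[ℝ] E, (0 : E →L[ℝ] E).comp L = 0 := fun L => by simp
  have h4 : HasMFDerivAt I 𝓘(ℝ, E) ((F ∘ (extChartAt I (1 : G)).symm) ∘ extChartAt I (1 : G)) 1
      (0 : E →L[ℝ] E) := by
    rw [← h3 (mfderiv I 𝓘(ℝ, E) (extChartAt I (1 : G)) 1)]
    exact h1
  refine h4.congr_of_eventuallyEq ?_
  filter_upwards [extChartAt_source_mem_nhds (I := I) (1 : G)] with g hg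
  simp only [Function.comp_apply, (extChartAt I (1 : G)).left_inv hg]

theorem IsTranslationLinear.eq_zero [ConnectedSpace G] {W : G → E} (hW : IsTranslationLinear I W)
    (hd : HasFDerivAt (chartField I W) (0 : E →L[ℝ] E) (chartOne I G)) (g : G) : W g = 0 := by
  set F : G → E := fun g => dRight I g⁻¹ g (W g) with hF
  -- Since `F k = F g + Ad g (F (g⁻¹ * k))`, the derivative at `g` factors through the one at the
  -- identity.
  have hder : ∀ g, HasMFDerivAt I 𝓘(ℝ, E) F g (0 : E →L[ℝ] E) := by
    intro g
    have h1 : HasMFDerivAt I 𝓘(ℝ, E) F (g⁻¹ * g) (0 : E →L[ℝ] E) := by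
      rw [inv_mul_cancel]
      exact hW.hasMFDerivAt_logDeriv_one hd
    have h2 := h1.comp g (hasMFDerivAt_mul_left I g⁻¹ g)
    set Ad : E →L[ℝ] E := (dRight I g⁻¹ g).comp (dLeft I g 1) with hAd
    have h3 : HasFDerivAt (fun v : E => F g + Ad v) Ad (F (g⁻¹ * g)) :=
      Ad.hasFDerivAt.const_add _
    have h4 := HasMFDerivAt.comp g (h3.hasMFDerivAt :) h2
    have h5 : ∀ L : E →L[ℝ] E, Ad.comp ((0 : E →L[ℝ] E).comp L) = 0 := fun L => by simp
    have h6 : HasMFDerivAt I 𝓘(ℝ, E) ((fun v : E => F g + Ad v) ∘ F ∘ fun k => g⁻¹ * k) g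
        (0 : E →L[ℝ] E) := by
      rw [← h5 (dLeft I g⁻¹ g)]
      exact h4
    refine h6.congr_of_eventuallyEq (.of_forall fun k => ?_)
    have h7 := hW.logDeriv_mul g (g⁻¹ * k)
    rw [mul_inv_cancel_left] at h7
    exact h7
  have h8 : F g = F 1 := (isLocallyConstant_of_hasMFDerivAt_zero hder).apply_eq_of_preconnectedSpace
    g 1
  have h9 : F 1 = 0 := by simp [hF, hW.map_one]
  have h10 : W g = dRight I g 1 (F g) := by
    simpa [dRight_one] using (dRight_comp I g⁻¹ g g (W g)).symm
  rw [h10, h8, h9, map_zero]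

theorem IsLinearField.eq_right_sub_left [CompleteSpace E] [ConnectedSpace G]
    {𝒳 : (g : G) → TangentSpace I g} (h𝒳 : IsLinearField I 𝒳) {X : GroupLieAlgebra I G}
    (hX : ∀ Z : GroupLieAlgebra I G, derivationOf I 𝒳 Z = ⁅X, Z⁆) (g : G) :
    (𝒳 g : E) = dRight I g 1 X - dLeft I g 1 X := by
  obtain ⟨V, rfl⟩ : ∃ V : G → E, V = 𝒳 := ⟨𝒳, rfl⟩
  obtain ⟨x, rfl⟩ : ∃ x : E, x = X := ⟨X, rfl⟩
  have hlin : IsTranslationLinear I V := h𝒳.isTranslationLinear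
  have hdiff : DifferentiableAt ℝ (chartField I V) (chartOne I G) := by
    have h1 : MDifferentiableWithinAt I I.tangent
        (fun g : G => (⟨g, V g⟩ : TangentBundle I G)) univ 1 :=
      (h𝒳.smooth.mdifferentiable (by simp) 1).mdifferentiableWithinAt
    have h2 := h1.differentiableWithinAt_mpullbackWithin_vectorField
    rw [preimage_univ, univ_inter] at h2
    have h3 : DifferentiableWithinAt ℝ (chartField I V) (range I) (chartOne I G) := h2
    rwa [I.range_eq_univ, differentiableWithinAt_univ] at h3
  obtain ⟨R, hR, hRd⟩ := exists_hasFDerivAt_chartField_rightField I (G := G) x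
  obtain ⟨L, hL, hLd⟩ := exists_hasFDerivAt_chartField_leftField I (G := G) x
  -- As `V 1 = 0`, the bracket of `V` with the right field of `Z` at the identity is `-V' Z`; the
  -- minus sign in `derivationOf` cancels this one.
  have hV' : ∀ Z : E, fderiv ℝ (chartField I V) (chartOne I G) Z =
      chartMulMixed I G x Z - chartMulMixed I G Z x := by
    intro Z
    obtain ⟨S, hS, hSd⟩ := exists_hasFDerivAt_chartField_rightField I (G := G) Z
    have h1 := mlieBracket_one I _ _ hdiff.hasFDerivAt hSd
    rw [hlin.map_one, map_zero, zero_sub, dRight_one] at h1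
    have h2 := (hX Z).trans (bracket_eq_chartMulMixed I x Z)
    rw [← h2, ← neg_neg (fderiv ℝ (chartField I V) (chartOne I G) Z), ← h1]
    rfl
  have hzero := (hlin.sub (isTranslationLinear_right_sub_left (I := I) (G := G) x)).eq_zero (by
    have h1 := hdiff.hasFDerivAt.sub (hRd.sub hLd)
    have h2 : fderiv ℝ (chartField I V) (chartOne I G) - (R - L) = 0 := by
      ext Z
      simp [hV', hR, hL]
    rw [h2] at h1
    refine h1.congr_of_eventuallyEq (.of_forall fun y => ?_)
    simp only [Pi.sub_apply, ← chartField_sub]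
    rfl) g
  exact sub_eq_zero.1 hzero

end LinearFields

end LieControl

/-! ### The theorem: comparison of the two systems. -/

theorem mainTheorem6
    {E : Type*} [NormedAddCommGroup E] [NormedSpace ℝ E] [FiniteDimensional ℝ E]
    {H : Type*} [TopologicalSpace H] (I : ModelWithCorners ℝ E H) [I.Boundaryless]
    {G : Type*} [TopologicalSpace G] [ChartedSpace H G] [Group G] [LieGroup I ∞ G]
    [T2Space G] [ConnectedSpace G]
    {m : ℕ} (𝒳 : Fin (m + 1) → (g : G) → TangentSpace I g)
    (h𝒳 : ∀ i, LieControl.IsLinearField I (𝒳 i))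
    (X Y : Fin (m + 1) → GroupLieAlgebra I G)
    (hX : ∀ i, ∀ Z : GroupLieAlgebra I G, LieControl.derivationOf I (𝒳 i) Z = ⁅X i, Z⁆)
    (u : Fin m → ℝ) (T : ℝ) (hT : 0 ≤ T) (g : G) :
    (∀ i, ∀ h : G, 𝒳 i h =
      LieControl.rightField I (X i) h
        + LieControl.invField I (LieControl.rightField I (X i)) h) ∧
    (∃ φA : ℝ → G, LieControl.IsSolutionOn (LieControl.affineField I 𝒳 Y u) T g φA) ∧
    (∃ φI : ℝ → G, LieControl.IsSolutionOn (LieControl.invariantField I X Y u) T g φI) ∧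
    ∀ φA φI : ℝ → G,
      LieControl.IsSolutionOn (LieControl.affineField I 𝒳 Y u) T g φA →
      LieControl.IsSolutionOn (LieControl.invariantField I X Y u) T g φI →
      ∀ t ∈ Set.Icc (0 : ℝ) T,
        φA t = φI t *
          LieControl.lieExp I ((-t) • ∑ i, (Fin.cons 1 u : Fin (m + 1) → ℝ) i • X i) := by
  open LieControl in
  have : CompleteSpace E := FiniteDimensional.complete ℝ E
  have hlin : ∀ i, ∀ h : G, (𝒳 i h : E) = dRight I h 1 (X i) - dLeft I h 1 (X i) :=
    fun i h => (h𝒳 i).eq_right_sub_left (hX i) h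
  obtain ⟨x, rfl⟩ : ∃ x : Fin (m + 1) → E, x = X := ⟨X, rfl⟩
  obtain ⟨y, rfl⟩ : ∃ y : Fin (m + 1) → E, y = Y := ⟨Y, rfl⟩
  obtain ⟨V, rfl⟩ : ∃ V : Fin (m + 1) → G → E, V = 𝒳 := ⟨𝒳, rfl⟩
  set A : E := ∑ i, (Fin.cons 1 u : Fin (m + 1) → ℝ) i • x i with hA
  set B : E := ∑ i, (Fin.cons 1 u : Fin (m + 1) → ℝ) i • y i with hB
  -- The zero left part lets the same solution lemmas serve this system, with the constant subgroup
  -- for `α`.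
  have hI : ∀ h : G, (invariantField I x y u h : E) =
      dRight I h 1 (A + B) - dLeft I h 1 0 := by
    intro h
    have : (invariantField I x y u h : E) = (dRight I h 1 (x 0) + dRight I h 1 (y 0)) +
      ∑ j : Fin m, u j • (dRight I h 1 (x j.succ) + dRight I h 1 (y j.succ)) := rfl
    rw [this, hA, hB]
    simp only [Fin.sum_univ_succ, Fin.cons_zero, Fin.cons_succ, map_add, map_sum, map_smul,
      smul_add, Finset.sum_add_distrib, one_smul, map_zero]
    abel
  have hAf : ∀ h : G, (affineField I V y u h : E) =
      dRight I h 1 (A + B) - dLeft I h 1 A := by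
    intro h
    have : (affineField I V y u h : E) = (V 0 h + dRight I h 1 (y 0)) +
      ∑ j : Fin m, u j • (V j.succ h + dRight I h 1 (y j.succ)) := rfl
    rw [this, hA, hB]
    simp only [hlin, Fin.sum_univ_succ, Fin.cons_zero, Fin.cons_succ, map_add, map_sum, map_smul,
      smul_add, smul_sub, Finset.sum_add_distrib, Finset.sum_sub_distrib, one_smul]
    abel
  obtain ⟨α, hα⟩ := exists_isOneParameterSubgroup (I := I) (G := G) A
  obtain ⟨β, hβ⟩ := exists_isOneParameterSubgroup (I := I) (G := G) (A + B)
  have h0 := isOneParameterSubgroup_zero (I := I) (G := G)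
  refine ⟨fun i h => ?_, ⟨_, isSolutionOn_of_right_sub_left hAf hα hβ T g⟩,
    ⟨_, isSolutionOn_of_right_sub_left hI h0 hβ T g⟩, fun φA φI hφA hφI t ht => ?_⟩
  · exact (hlin i h).trans ((sub_eq_add_neg _ _).trans
      (congrArg (dRight I h 1 (x i) + ·) (invField_rightField (x i) h).symm))
  · rw [hφA.eq_of_right_sub_left hAf hα hβ ht, hφI.eq_of_right_sub_left hI h0 hβ ht, mul_one]
    exact congrArg _ (lieExp_smul hα (-t)).symm
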